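/- A graph $H$ is a \emph{threshold graph} if there are $s\in\mathbb{R}$ and $w:V(H)\to\mathbb{R}$ such that distinct vertices $u,v$ are adjacent if and only if $w(u)+w(v)\ge s$. The \emph{threshold dimension} $t(G)$ of a finite graph $G$ is the minimum number of threshold subgraphs of $G$ whose edge sets together cover $E(G)$. A graph is a \emph{split graph} if its vertex set can be partitioned into a clique and an independent set. Let $b>1$ be any fixed real number and let $\log$ denote the logarithm to base $b$. There is a polynomial-time $2\left\lceil \frac{n\sqrt{\log\log n}}{\sqrt{\log n}}\right\rceil$-factor approximation algorithm for the threshold dimension of split graphs on $n$ vertices. That is, there are a program for a random access machine (with unit cost, and with addition and truncated subtraction as its arithmetic) and a polynomial $p$ such that, given the number $n$ and the adjacency matrix of any split graph $G$ on the vertex set $\{0,\dots,n-1\}$, the program halts after at most $p(n)$ steps and outputs a natural number $A(G)$ with $t(G)\le A(G)$ and, whenever $n>b$ (that is, whenever $\log\log n$ is defined and positive), $$A(G)\le 2\left\lceil \frac{n\sqrt{\log\log n}}{\sqrt{\log n}}\right\rceil\, t(G).$$ -/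

import Mathlib

namespace SimpleGraph

/-- A split graph: the vertex set is the disjoint union of a clique and an independent set. -/
def IsSplitGraph {V : Type*} (G : SimpleGraph V) : Prop :=
  ∃ K : Set V, G.IsClique K ∧ G.IsIndepSet Kᶜ

/-- A threshold graph: distinct `u`, `v` are adjacent iff `w u + w v ≥ s`, for some real
vertex weights `w` and some real `s`. -/
def IsThresholdGraph {V : Type*} (G : SimpleGraph V) : Prop :=
  ∃ (s : ℝ) (w : V → ℝ), ∀ u v : V, u ≠ v → (G.Adj u v ↔ w u + w v ≥ s)

/-- The edges of `G` can be covered by `k` threshold subgraphs of `G`. Spanning subgraphs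
suffice: adding isolated vertices to a threshold graph gives a threshold graph. -/
def HasThresholdCover {V : Type*} (G : SimpleGraph V) (k : ℕ) : Prop :=
  ∃ T : Fin k → SimpleGraph V,
    (∀ i, T i ≤ G ∧ (T i).IsThresholdGraph) ∧ ∀ u v, G.Adj u v → ∃ i, (T i).Adj u v

/-- The threshold dimension `t(G)` : the minimum number of threshold subgraphs of `G` needed to
cover the edges of `G`. -/
noncomputable def thresholdDimension {V : Type*} (G : SimpleGraph V) : ℕ :=
  sInf {k | G.HasThresholdCover k}

/-- The subgraph of `G` with the single possible edge `xy` is a threshold graph. -/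
theorem isThresholdGraph_inf_edge {V : Type*} (G : SimpleGraph V) (x y : V) :
    (G ⊓ SimpleGraph.edge x y).IsThresholdGraph := by
  classical
  by_cases h : G.Adj x y
  · refine ⟨2, fun v => if v = x ∨ v = y then 1 else 0, fun u v huv => ?_⟩
    rw [SimpleGraph.inf_adj, SimpleGraph.edge_adj]
    constructor
    · rintro ⟨-, (⟨rfl, rfl⟩ | ⟨rfl, rfl⟩), -⟩ <;> norm_num
    · intro h2
      have hu : u = x ∨ u = y := by
        by_contra hu
        simp only [hu, if_false] at h2
        split_ifs at h2 <;> norm_num at h2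
      have hv : v = x ∨ v = y := by
        by_contra hv
        simp only [hv, if_false] at h2
        split_ifs at h2 <;> norm_num at h2
      rcases hu with rfl | rfl <;> rcases hv with rfl | rfl
      · exact absurd rfl huv
      · exact ⟨h, by simp, huv⟩
      · exact ⟨h.symm, by simp, huv⟩
      · exact absurd rfl huv
  · refine ⟨1, fun _ => 0, fun u v huv => ?_⟩
    rw [SimpleGraph.inf_adj, SimpleGraph.edge_adj]
    constructor
    · rintro ⟨h', (⟨rfl, rfl⟩ | ⟨rfl, rfl⟩), -⟩
      · exact absurd h' h
      · exact absurd h'.symm h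
    · intro h'
      norm_num at h'

/-- A finite graph has a threshold cover (one subgraph for each pair of vertices), so that
`thresholdDimension` is a genuine minimum. -/
theorem exists_hasThresholdCover {V : Type*} [Finite V] (G : SimpleGraph V) :
    ∃ k, G.HasThresholdCover k := by
  obtain ⟨k, ⟨e⟩⟩ := Finite.exists_equiv_fin (V × V)
  refine ⟨k, fun i => G ⊓ SimpleGraph.edge (e.symm i).1 (e.symm i).2,
    fun i => ⟨inf_le_left, G.isThresholdGraph_inf_edge _ _⟩, fun u v huv => ⟨e (u, v), ?_⟩⟩
  simp [SimpleGraph.edge_adj, huv, huv.ne]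

end SimpleGraph

/-! A random access machine, programmed by structured programs, with unit cost. A machine state
consists of registers and of one-dimensional arrays, all of whose cells hold natural numbers; a
program names finitely many registers and arrays, and array cells are addressed indirectly. The
arithmetic is addition and truncated subtraction only. There is no multiplication, so that the
bit length of a number grows by at most a constant in each step, and hence the polynomial-time
computations of this model are those of Turing machines. -/

namespace Ram

/-- Machine states: the content of the registers and of the arrays. -/
structure State where
  reg : ℕ → ℕ
  arr : ℕ → ℕ → ℕ

/-- Arithmetic expressions. `read a i` is the cell with address `i` of the array named `a`. -/
inductive Expr where
  | const (c : ℕ) : Expr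
  | reg (x : ℕ) : Expr
  | read (a : ℕ) (i : Expr) : Expr
  | add (e f : Expr) : Expr
  | sub (e f : Expr) : Expr

/-- The value of an expression in a state. -/
def Expr.eval (σ : State) : Expr → ℕ
  | .const c => c
  | .reg x => σ.reg x
  | .read a i => σ.arr a (i.eval σ)
  | .add e f => e.eval σ + f.eval σ
  | .sub e f => e.eval σ - f.eval σ

/-- Programs. In `cond` and `loop`, the test `e` succeeds when its value is not `0`. -/
inductive Prog where
  | skip : Prog
  | assign (x : ℕ) (e : Expr) : Prog
  | store (a : ℕ) (i e : Expr) : Prog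
  | seq (P Q : Prog) : Prog
  | cond (e : Expr) (P Q : Prog) : Prog
  | loop (e : Expr) (P : Prog) : Prog

/-- The state after the register `x` has received the value `c`. -/
def State.setReg (σ : State) (x c : ℕ) : State :=
  { σ with reg := Function.update σ.reg x c }

/-- The state after the cell `i` of the array `a` has received the value `c`. -/
def State.setArr (σ : State) (a i c : ℕ) : State :=
  { σ with arr := Function.update σ.arr a (Function.update (σ.arr a) i c) }

/-- `Exec P σ τ T`: started in the state `σ`, the program `P` halts in the state `τ` after
exactly `T` steps. Each elementary command and each evaluation of a test is one step (the
expressions in a fixed program have bounded size). -/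
inductive Exec : Prog → State → State → ℕ → Prop where
  | skip (σ : State) : Exec .skip σ σ 1
  | assign (x : ℕ) (e : Expr) (σ : State) :
      Exec (.assign x e) σ (σ.setReg x (e.eval σ)) 1
  | store (a : ℕ) (i e : Expr) (σ : State) :
      Exec (.store a i e) σ (σ.setArr a (i.eval σ) (e.eval σ)) 1
  | seq {P Q : Prog} {σ τ υ : State} {S T : ℕ} :
      Exec P σ τ S → Exec Q τ υ T → Exec (.seq P Q) σ υ (S + T)
  | cond_true {e : Expr} {P Q : Prog} {σ τ : State} {T : ℕ} :
      e.eval σ ≠ 0 → Exec P σ τ T → Exec (.cond e P Q) σ τ (T + 1)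
  | cond_false {e : Expr} {P Q : Prog} {σ τ : State} {T : ℕ} :
      e.eval σ = 0 → Exec Q σ τ T → Exec (.cond e P Q) σ τ (T + 1)
  | loop_done {e : Expr} {P : Prog} {σ : State} :
      e.eval σ = 0 → Exec (.loop e P) σ σ 1
  | loop_again {e : Expr} {P : Prog} {σ τ υ : State} {S T : ℕ} :
      e.eval σ ≠ 0 → Exec P σ τ S → Exec (.loop e P) τ υ T →
      Exec (.loop e P) σ υ (S + T + 1)

/-- The machine is deterministic: the final state and the number of steps are unique. -/
theorem Exec.deterministic {P : Prog} {σ τ τ' : State} {T T' : ℕ}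
    (h : Exec P σ τ T) (h' : Exec P σ τ' T') : τ = τ' ∧ T = T' := by
  induction h generalizing τ' T' with
  | skip => cases h'; exact ⟨rfl, rfl⟩
  | assign => cases h'; exact ⟨rfl, rfl⟩
  | store => cases h'; exact ⟨rfl, rfl⟩
  | seq _ _ ih1 ih2 =>
    cases h' with
    | seq a b =>
      obtain ⟨rfl, rfl⟩ := ih1 a
      obtain ⟨rfl, rfl⟩ := ih2 b
      exact ⟨rfl, rfl⟩
  | cond_true hne _ ih =>
    cases h' with
    | cond_true _ a => obtain ⟨rfl, rfl⟩ := ih a; exact ⟨rfl, rfl⟩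
    | cond_false h0 _ => exact absurd h0 hne
  | cond_false h0 _ ih =>
    cases h' with
    | cond_true hne _ => exact absurd h0 hne
    | cond_false _ a => obtain ⟨rfl, rfl⟩ := ih a; exact ⟨rfl, rfl⟩
  | loop_done h0 =>
    cases h' with
    | loop_done => exact ⟨rfl, rfl⟩
    | loop_again hne _ _ => exact absurd h0 hne
  | loop_again hne _ _ ih1 ih2 =>
    cases h' with
    | loop_done h0 => exact absurd h0 hne
    | loop_again _ a b =>
      obtain ⟨rfl, rfl⟩ := ih1 a
      obtain ⟨rfl, rfl⟩ := ih2 b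
      exact ⟨rfl, rfl⟩

open Classical in
/-- The initial state for an input graph `G` with vertices `0, …, n - 1`: register `0` holds `n`,
array `0` holds the adjacency matrix row by row, and all other cells hold `0`. -/
noncomputable def graphInput {n : ℕ} (G : SimpleGraph (Fin n)) : State where
  reg x := if x = 0 then n else 0
  arr a i := if a = 0 ∧ ∃ u v : Fin n, G.Adj u v ∧ i = n * (u : ℕ) + (v : ℕ) then 1 else 0

end Ram

/-! A split graph has a split partition that can be read off the degrees
(`SimpleGraph.IsSplitGraph.exists_degree`). Cut the independent side into blocks of `k` consecutive
labels. A threshold subgraph, restricted to the edges between the clique and one block, is a chain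
graph: if it joins `v` to `u`, it joins `v` to every heavier vertex of the block. Only the order of
the weights within the block matters, so they may be replaced by ranks below `k`, and `k` weight
functions form a number with `k * k` digits in base `k` (`Covered.of_weights`). If `k ^ (k * k) ≤ n
+ c` with `c` constant, all codes can be tried in polynomial time, which gives the exact optimum for
each block.

A threshold cover of `G` restricts to every block, so each block optimum is at most `t(G)`
(`blockCover_ofGraph_le`). Conversely, a chain graph together with the whole clique is a threshold
graph (`isThresholdGraph_chainGraph`), so the block covers combine to a cover of `G`, with one more
graph for the edges inside the clique. The result is at most `(⌈n / k⌉ + 1) * t(G)` (`approx_le`).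
The largest admissible `k` has `k ^ 2 * log k` close to `log n`, so `k ^ 2` is about `2 * log n /
log log n`; the factor 2 here is the slack in `eventually_div_le`.

Polynomial running time comes from closure properties of `Computes` and `Decides`: every loop runs
for `bound` rounds, and `bound` is `n + c`. -/

/-! ### Closure of polynomial-time functions under composition, branching and iteration -/

namespace Ram

/-- The data available to a program: the number of vertices, a bound for the number of
iterations of each loop, and the cells of the input array. -/
structure Input where
  n : ℕ
  bound : ℕ
  cell : ℕ → ℕ
  n_le : n ≤ bound

/-- A context: an input together with finitely many variables holding natural numbers. -/
class Context (Γ : Type) where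
  size : ℕ
  value : ℕ → Γ → ℕ
  input : Γ → Input

open Context

instance : Context Input where
  size := 0
  value _ _ := 0
  input := id

/-- The context `Γ` extended by one variable. -/
instance {Γ : Type} [Context Γ] : Context (Γ × ℕ) where
  size := size Γ + 1
  value i γ := if i < size Γ then value i γ.1 else γ.2
  input γ := input γ.1

variable {Γ : Type} [Context Γ]

@[simp] theorem input_self (I : Input) : input I = I := rfl

@[simp] theorem input_prod (γ : Γ × ℕ) : input γ = input γ.1 := rfl

/-- The state `σ` holds the input in its standard place, and the `i`-th variable in the
register `l i`. -/
structure Represents (l : ℕ → ℕ) (σ : State) (γ : Γ) : Prop where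
  var : ∀ i < size Γ, σ.reg (l i) = value i γ
  n : σ.reg 0 = (input γ).n
  bound : σ.reg 1 = (input γ).bound
  cell : σ.arr 0 = (input γ).cell

/-- All variables and the input size live in registers below `m`, so a program that writes only from
`m` upwards can be followed by another one for the same context. -/
theorem Represents.of_agree {l : ℕ → ℕ} {σ τ : State} {γ : Γ} (h : Represents l σ γ) {m : ℕ}
    (hm : 2 ≤ m) (hl : ∀ i < size Γ, l i < m) (hr : ∀ r < m, τ.reg r = σ.reg r)
    (ha : τ.arr = σ.arr) : Represents l τ γ where
  var i hi := by rw [hr _ (hl i hi), h.var i hi]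
  n := by rw [hr _ (by omega), h.n]
  bound := by rw [hr _ (by omega), h.bound]
  cell := by rw [ha, h.cell]

/-- `P` puts `f γ` into the register `m` and preserves all registers below `m` and all arrays,
within the number of steps that is given by the polynomial `p` in the loop bound. -/
def Realizes (P : Prog) (p : Polynomial ℕ) (l : ℕ → ℕ) (m : ℕ) (f : Γ → ℕ) : Prop :=
  ∀ (σ : State) (γ : Γ), Represents l σ γ → ∃ (τ : State) (T : ℕ),
    Exec P σ τ T ∧ T ≤ p.eval (input γ).bound ∧ τ.reg m = f γ ∧
      (∀ r < m, τ.reg r = σ.reg r) ∧ τ.arr = σ.arr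

/-- `f` is computed by a program whose number of steps is polynomial in the loop bound. -/
def Computes (f : Γ → ℕ) : Prop :=
  ∃ p : Polynomial ℕ, ∀ (l : ℕ → ℕ) (m : ℕ), 2 ≤ m → (∀ i < size Γ, l i < m) →
    ∃ P : Prog, Realizes P p l m f

open Classical in
/-- `p` is decided by a program whose number of steps is polynomial in the loop bound. -/
def Decides (p : Γ → Prop) : Prop :=
  Computes fun γ => if p γ then 1 else 0

namespace Computes

variable {f g : Γ → ℕ} {p : Γ → Prop}

theorem of_expr (e : (ℕ → ℕ) → Expr)
    (he : ∀ l σ γ, Represents l σ γ → (e l).eval σ = f γ) : Computes f := by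
  refine ⟨1, fun l m _ _ => ⟨.assign m (e l), fun σ γ hσ =>
    ⟨_, 1, .assign _ _ _, by simp, ?_, fun r hr => ?_, rfl⟩⟩⟩
  · simp [State.setReg, he l σ γ hσ]
  · simp [State.setReg, hr.ne]

theorem const (c : ℕ) : Computes (fun _ : Γ => c) :=
  of_expr (fun _ => .const c) fun _ _ _ _ => rfl

theorem n : Computes (fun γ : Γ => (input γ).n) :=
  of_expr (fun _ => .reg 0) fun _ _ _ h => h.n

theorem bound : Computes (fun γ : Γ => (input γ).bound) :=
  of_expr (fun _ => .reg 1) fun _ _ _ h => h.bound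

theorem snd : Computes (fun γ : Γ × ℕ => γ.2) :=
  of_expr (fun l => .reg (l (size Γ))) fun _ _ γ h => by
    have := h.var (size Γ) (Nat.lt_succ_self _)
    simpa [Expr.eval, value] using this

theorem fst (hf : Computes f) : Computes (fun γ : Γ × ℕ => f γ.1) := by
  obtain ⟨p, hp⟩ := hf
  refine ⟨p, fun l m hm hl => ?_⟩
  obtain ⟨P, hP⟩ := hp l m hm fun i hi => hl i (Nat.lt_succ_of_lt hi)
  refine ⟨P, fun σ γ hσ => hP σ γ.1 ⟨fun i hi => ?_, hσ.n, hσ.bound, hσ.cell⟩⟩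
  have := hσ.var i (Nat.lt_succ_of_lt hi)
  simpa [value, hi] using this

/-- Combine the values of two functions by an expression. -/
theorem map₂ (hf : Computes f) (hg : Computes g) {F : ℕ → ℕ → ℕ} (e : ℕ → ℕ → Expr)
    (he : ∀ x y σ, (e x y).eval σ = F (σ.reg x) (σ.reg y)) :
    Computes (fun γ => F (f γ) (g γ)) := by
  obtain ⟨p, hp⟩ := hf
  obtain ⟨q, hq⟩ := hg
  refine ⟨p + q + 1, fun l m hm hl => ?_⟩
  obtain ⟨P, hP⟩ := hp l m hm hl
  obtain ⟨Q, hQ⟩ := hq l (m + 1) (by omega) fun i hi => Nat.lt_succ_of_lt (hl i hi)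
  refine ⟨.seq (.seq P Q) (.assign m (e m (m + 1))), fun σ γ hσ => ?_⟩
  obtain ⟨τ, S, hS, hSp, hfm, hr, ha⟩ := hP σ γ hσ
  obtain ⟨υ, T, hT, hTp, hgm, hr', ha'⟩ := hQ τ γ (hσ.of_agree hm hl hr ha)
  refine ⟨_, _, .seq (.seq hS hT) (.assign _ _ _), ?_, ?_, fun r hrm => ?_, ?_⟩
  · simp; omega
  · simp [State.setReg, he, hgm, hr' m (Nat.lt_succ_self m), hfm]
  · simp [State.setReg, hrm.ne, hr' r (by omega), hr r hrm]
  · simp [State.setReg, ha, ha']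

theorem add (hf : Computes f) (hg : Computes g) : Computes (fun γ => f γ + g γ) :=
  hf.map₂ hg (fun x y => .add (.reg x) (.reg y)) fun _ _ _ => rfl

theorem sub (hf : Computes f) (hg : Computes g) : Computes (fun γ => f γ - g γ) :=
  hf.map₂ hg (fun x y => .sub (.reg x) (.reg y)) fun _ _ _ => rfl

theorem cell (hf : Computes f) : Computes (fun γ => (input γ).cell (f γ)) := by
  obtain ⟨p, hp⟩ := hf
  refine ⟨p + 1, fun l m hm hl => ?_⟩
  obtain ⟨P, hP⟩ := hp l m hm hl
  refine ⟨.seq P (.assign m (.read 0 (.reg m))), fun σ γ hσ => ?_⟩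
  obtain ⟨τ, S, hS, hSp, hfm, hr, ha⟩ := hP σ γ hσ
  refine ⟨_, _, .seq hS (.assign _ _ _), ?_, ?_, fun r hrm => ?_, ?_⟩
  · simp; omega
  · simp [State.setReg, Expr.eval, hfm, ha, hσ.cell]
  · simp [State.setReg, hrm.ne, hr r hrm]
  · simp [State.setReg, ha]

theorem ite [DecidablePred p] (hp : Decides p) (hf : Computes f) (hg : Computes g) :
    Computes (fun γ => if p γ then f γ else g γ) := by
  obtain ⟨a, ha⟩ := hp
  obtain ⟨b, hb⟩ := hf
  obtain ⟨c, hc⟩ := hg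
  refine ⟨a + b + c + 1, fun l m hm hl => ?_⟩
  obtain ⟨P, hP⟩ := ha l m hm hl
  obtain ⟨Q, hQ⟩ := hb l m hm hl
  obtain ⟨R, hR⟩ := hc l m hm hl
  refine ⟨.seq P (.cond (.reg m) Q R), fun σ γ hσ => ?_⟩
  obtain ⟨τ, S, hS, hSp, hfm, hr, har⟩ := hP σ γ hσ
  by_cases h : p γ
  · obtain ⟨υ, T, hT, hTp, hgm, hr', har'⟩ := hQ τ γ (hσ.of_agree hm hl hr har)
    refine ⟨_, _, .seq hS (.cond_true ?_ hT), ?_, ?_, fun r hrm => ?_, ?_⟩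
    · simp [Expr.eval, hfm, h]
    · simp; omega
    · simp [h, hgm]
    · rw [hr' r hrm, hr r hrm]
    · rw [har', har]
  · obtain ⟨υ, T, hT, hTp, hgm, hr', har'⟩ := hR τ γ (hσ.of_agree hm hl hr har)
    refine ⟨_, _, .seq hS (.cond_false ?_ hT), ?_, ?_, fun r hrm => ?_, ?_⟩
    · simp [Expr.eval, hfm, h]
    · simp; omega
    · simp [h, hgm]
    · rw [hr' r hrm, hr r hrm]
    · rw [har', har]

/-- Iteration, with as many rounds as the loop bound says. -/
theorem iterate (hf : Computes f) {s : Γ → ℕ → ℕ → ℕ}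
    (hs : Computes (fun γ : (Γ × ℕ) × ℕ => s γ.1.1 γ.1.2 γ.2)) :
    Computes (fun γ => Nat.rec (f γ) (s γ) (input γ).bound) := by
  obtain ⟨a, ha⟩ := hf
  obtain ⟨b, hb⟩ := hs
  refine ⟨a + 1 + (.X * (b + 3) + 1), fun l m hm hl => ?_⟩
  obtain ⟨P, hP⟩ := ha l m hm hl
  -- Register `m` holds the accumulator and `m + 1` the round counter, which are the two newest
  -- variables of the body; the body works from `m + 2` on.
  let l' : ℕ → ℕ := fun i => if i < size Γ then l i else if i = size Γ then m + 1 else m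
  obtain ⟨Q, hQ⟩ := hb l' (m + 2) (by omega) fun i hi => by
    simp only [l']
    split_ifs with h
    · have := hl i h
      omega
    · omega
    · omega
  let body : Prog := .seq (.seq Q (.assign m (.reg (m + 2))))
    (.assign (m + 1) (.add (.reg (m + 1)) (.const 1)))
  let L : Prog := .loop (.sub (.reg 1) (.reg (m + 1))) body
  refine ⟨.seq (.seq P (.assign (m + 1) (.const 0))) L, fun σ γ hσ => ?_⟩
  -- Loop invariant, by induction on the number `k` of remaining rounds; `j` rounds are already
  -- done.
  have key : ∀ (k j : ℕ) (τ : State), j + k = (input γ).bound →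
      τ.reg m = Nat.rec (f γ) (s γ) j → τ.reg (m + 1) = j → (∀ r < m, τ.reg r = σ.reg r) →
      τ.arr = σ.arr → ∃ (υ : State) (T : ℕ), Exec L τ υ T ∧
        T ≤ k * (b.eval (input γ).bound + 3) + 1 ∧
        υ.reg m = Nat.rec (f γ) (s γ) (input γ).bound ∧
        (∀ r < m, υ.reg r = σ.reg r) ∧ υ.arr = σ.arr := by
    intro k
    induction k with
    | zero =>
      intro j τ hj hacc hi hr har
      have h1 : τ.reg 1 = (input γ).bound := by rw [hr 1 (by omega), hσ.bound]
      refine ⟨τ, 1, .loop_done ?_, by simp, ?_, hr, har⟩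
      · simp [Expr.eval, h1, hi]; omega
      · rw [hacc, ← hj, add_zero]
    | succ k ih =>
      intro j τ hj hacc hi hr har
      have hτ : Represents l τ γ := hσ.of_agree hm hl hr har
      have hτ' : Represents l' τ (((γ, j), τ.reg m) : (Γ × ℕ) × ℕ) := by
        refine ⟨fun i his => ?_, hτ.n, hτ.bound, hτ.cell⟩
        have his' : i < size Γ + 1 + 1 := his
        by_cases h : i < size Γ
        · have h2 : i < size Γ + 1 := by omega
          simpa [l', value, h, size, h2] using hτ.var i h
        · by_cases h' : i = size Γ
          · simp [l', h', value, size, hi]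
          · have h2 : ¬ i < size Γ + 1 := by omega
            simp [l', h, h', value, size, h2]
      obtain ⟨υ, T, hT, hTb, hv, hrv, hav⟩ := hQ τ _ hτ'
      have h1 : τ.reg 1 = (input γ).bound := hτ.bound
      let υ' := (υ.setReg m (υ.reg (m + 2)))
      let υ'' := υ'.setReg (m + 1) (j + 1)
      have hbody : Exec body τ υ'' (T + 1 + 1) := by
        have e1 : Exec (.assign m (.reg (m + 2))) υ υ' 1 := .assign _ _ _
        have e2 : Exec (.assign (m + 1) (.add (.reg (m + 1)) (.const 1))) υ' υ'' 1 := by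
          have := Exec.assign (m + 1) (.add (.reg (m + 1)) (.const 1)) υ'
          have h3 : Expr.eval υ' (.add (.reg (m + 1)) (.const 1)) = j + 1 := by
            simp [Expr.eval, υ', State.setReg, hrv (m + 1) (by omega), hi]
          rwa [h3] at this
        exact .seq (.seq hT e1) e2
      obtain ⟨ω, S, hS, hSb, hw, hrw, haw⟩ := ih (j + 1) υ'' (by omega)
        (by simp [υ'', υ', State.setReg, hv, hacc]) (by simp [υ'', State.setReg])
        (fun r hrm => by
          have h4 : r ≠ m + 1 := by omega
          simp [υ'', υ', State.setReg, hrm.ne, h4, hrv r (by omega), hr r hrm])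
        (by simp [υ'', υ', State.setReg, hav, har])
      refine ⟨ω, _, .loop_again ?_ hbody hS, ?_, hw, hrw, haw⟩
      · simp [Expr.eval, h1, hi]; omega
      · simp only [input_prod] at hTb
        rw [add_mul]
        omega
  obtain ⟨τ, S, hS, hSp, hfm, hr, har⟩ := hP σ γ hσ
  obtain ⟨υ, T, hT, hTb, hv, hrv, hav⟩ := key (input γ).bound 0 (τ.setReg (m + 1) 0) (by simp)
    (by simp [State.setReg, hfm]) (by simp [State.setReg])
    (fun r hrm => by
      have h4 : r ≠ m + 1 := by omega
      simp [State.setReg, h4, hr r hrm])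
    (by simp [State.setReg, har])
  refine ⟨υ, _, .seq (.seq hS (.assign _ _ _)) hT, ?_, hv, hrv, hav⟩
  simp
  omega

end Computes

end Ram

/-! ### Decidable predicates, bounded quantifiers and arithmetic -/

namespace Ram
open Context

variable {Γ : Type} [Context Γ]

open Classical in
theorem Decides.congr {p q : Γ → Prop} (hp : Decides p) (h : ∀ γ, q γ ↔ p γ) : Decides q := by
  rwa [show q = p from funext fun γ => propext (h γ)]

theorem Computes.congr {f g : Γ → ℕ} (hf : Computes f) (h : ∀ γ, g γ = f γ) : Computes g := by
  rwa [show g = f from funext h]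

namespace Decides

variable {f g : Γ → ℕ} {p q : Γ → Prop}

theorem indicator [DecidablePred p] (hp : Decides p) :
    Computes (fun γ => if p γ then 1 else 0) :=
  Computes.congr hp fun γ => by congr

theorem fst (hp : Decides p) : Decides (fun γ : Γ × ℕ => p γ.1) :=
  Computes.fst hp

open Classical in
theorem not (hp : Decides p) : Decides (fun γ => ¬ p γ) :=
  ((Computes.const 1).sub hp).congr fun γ => by by_cases h : p γ <;> simp [h]

open Classical in
theorem and (hp : Decides p) (hq : Decides q) : Decides (fun γ => p γ ∧ q γ) :=
  (Computes.ite hp hq (Computes.const 0)).congr fun γ => by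
    by_cases h : p γ <;> simp [h]

theorem imp (hp : Decides p) (hq : Decides q) : Decides (fun γ => p γ → q γ) :=
  (hp.and hq.not).not.congr fun γ => by tauto

theorem lt (hf : Computes f) (hg : Computes g) : Decides (fun γ => f γ < g γ) :=
  -- With truncated subtraction, `1 - (1 - x)` is the indicator of `x > 0`.
  ((Computes.const 1).sub ((Computes.const 1).sub (hg.sub hf))).congr fun γ => by
    split_ifs <;> omega

theorem le (hf : Computes f) (hg : Computes g) : Decides (fun γ => f γ ≤ g γ) :=
  (lt hg hf).not.congr fun _ => not_lt.symm

theorem eq (hf : Computes f) (hg : Computes g) : Decides (fun γ => f γ = g γ) :=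
  ((le hf hg).and (le hg hf)).congr fun _ => le_antisymm_iff

end Decides

namespace Computes

variable {f g : Γ → ℕ}

protected theorem min (hf : Computes f) (hg : Computes g) : Computes (fun γ => Min.min (f γ) (g γ)) :=
  (hf.sub (hf.sub hg)).congr fun _ => by omega

-- Loops always run for `bound` rounds, so the terms with index at least `N` are masked to zero;
-- `hle` ensures that no term is lost.
open Finset in
theorem sum {N : Γ → ℕ} {s : Γ → ℕ → ℕ} (hN : Computes N)
    (hs : Computes (fun γ : Γ × ℕ => s γ.1 γ.2)) (hle : ∀ γ, N γ ≤ (input γ).bound) :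
    Computes (fun γ => ∑ i ∈ range (N γ), s γ i) := by
  classical
  have h : Computes (fun γ : (Γ × ℕ) × ℕ => γ.2 + if γ.1.2 < N γ.1.1 then s γ.1.1 γ.1.2 else 0) :=
    snd.add (fst (ite (Decides.lt snd hN.fst) hs (const 0)))
  refine ((const 0).iterate (s := fun γ i acc => acc + if i < N γ then s γ i else 0)
    h).congr fun γ => ?_
  have key : ∀ B, (Nat.rec 0 (fun i acc => acc + if i < N γ then s γ i else 0) B : ℕ)
      = ∑ i ∈ range B, if i < N γ then s γ i else 0 := by
    intro B
    induction B with
    | zero => rfl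
    | succ B ih => rw [sum_range_succ, ← ih]
  rw [key, ← sum_filter]
  congr 1
  ext i
  have := hle γ
  simp only [mem_range, mem_filter]
  omega

/-- Multiplication, with the first factor cut off at the loop bound. -/
theorem mul (hf : Computes f) (hg : Computes g) :
    Computes (fun γ => Min.min (f γ) (input γ).bound * g γ) :=
  (sum (s := fun γ _ => g γ) (hf.min bound) hg.fst fun _ => min_le_right _ _).congr fun γ => by
    simp

end Computes

namespace Decides

/-- Count the counterexamples and compare with zero. -/
theorem ball {N : Γ → ℕ} {p : Γ → ℕ → Prop} (hN : Computes N)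
    (hp : Decides (fun γ : Γ × ℕ => p γ.1 γ.2)) (hle : ∀ γ, N γ ≤ (input γ).bound) :
    Decides (fun γ => ∀ i < N γ, p γ i) := by
  classical
  exact (eq (Computes.sum (s := fun γ i => if ¬ p γ i then 1 else 0) hN
    (Decides.not hp).indicator hle) (Computes.const 0)).congr fun γ => by simp

theorem bex {N : Γ → ℕ} {p : Γ → ℕ → Prop} (hN : Computes N)
    (hp : Decides (fun γ : Γ × ℕ => p γ.1 γ.2)) (hle : ∀ γ, N γ ≤ (input γ).bound) :
    Decides (fun γ => ∃ i < N γ, p γ i) :=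
  (ball (p := fun γ i => ¬ p γ i) hN hp.not hle).not.congr fun γ => by simp

end Decides

namespace Computes

variable {f g : Γ → ℕ}

/-- Division, with the dividend cut off at the loop bound. -/
theorem div (hf : Computes f) (hg : Computes g) :
    Computes (fun γ => Min.min (f γ) (input γ).bound / g γ) := by
  classical
  -- The quotient is the number of `i` for which `i + 1` copies of the divisor fit into the
  -- dividend. The guard makes the count zero for divisor zero, as in `Nat.div`.
  have h : Decides (fun γ : Γ × ℕ => 0 < g γ.1 ∧
      Min.min (γ.2 + 1) (input γ).bound * g γ.1 ≤ Min.min (f γ.1) (input γ).bound) :=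
    (Decides.lt (const 0) hg.fst).and (.le ((snd.add (const 1)).mul hg.fst) (hf.fst.min bound))
  refine (sum (s := fun γ i => if 0 < g γ ∧ Min.min (i + 1) (input γ).bound * g γ ≤
    Min.min (f γ) (input γ).bound then 1 else 0) bound h.indicator
    fun γ => le_rfl).congr fun γ => ?_
  rw [← Finset.sum_filter, Finset.sum_const, smul_eq_mul, mul_one]
  rcases Nat.eq_zero_or_pos (g γ) with h0 | h0
  · simp [h0]
  · rw [← Finset.card_range (Min.min (f γ) (input γ).bound / g γ)]
    congr 1
    ext i
    simp only [Finset.mem_range, Finset.mem_filter, h0, true_and]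
    have h1 := Nat.div_le_self (Min.min (f γ) (input γ).bound) (g γ)
    have h2 := min_le_right (f γ) (input γ).bound
    have h3 := Nat.le_div_iff_mul_le h0 (x := i + 1) (y := Min.min (f γ) (input γ).bound)
    constructor
    · intro hi
      have : i < (input γ).bound := by omega
      refine ⟨this, ?_⟩
      rw [min_eq_left (by omega)]
      exact h3.1 hi
    · rintro ⟨hi, h⟩
      rw [min_eq_left (by omega)] at h
      exact h3.2 h

/-- Remainders, with the dividend cut off at the loop bound. -/
theorem mod (hf : Computes f) (hg : Computes g) :
    Computes (fun γ => Min.min (f γ) (input γ).bound % g γ) := by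
  refine ((hf.min bound).sub ((div hf hg).mul hg)).congr fun γ => ?_
  have h1 := Nat.div_le_self (Min.min (f γ) (input γ).bound) (g γ)
  have h2 := min_le_right (f γ) (input γ).bound
  have h3 := Nat.div_add_mod' (Min.min (f γ) (input γ).bound) (g γ)
  rw [min_eq_left (h1.trans h2)]
  omega

/-- Powers, with the base and the exponent cut off at the loop bound. -/
theorem pow (hf : Computes f) (hg : Computes g) :
    Computes (fun γ => Min.min (f γ) (input γ).bound ^ Min.min (g γ) (input γ).bound) := by
  classical
  have h := (ite (Decides.lt snd hg.fst).fst (mul (Γ := (Γ × ℕ) × ℕ) hf.fst.fst snd) snd)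
  refine ((const 1).iterate (s := fun γ i acc =>
    if i < g γ then Min.min (f γ) (input γ).bound * acc else acc)
    h).congr fun γ => ?_
  generalize (input γ).bound = B
  generalize Min.min (f γ) B = x
  induction B with
  | zero => simp
  | succ B ih =>
    simp only
    rw [← ih]
    split_ifs with h
    · rw [min_eq_right h, min_eq_right h.le, pow_succ']
    · rw [min_eq_left (by omega), min_eq_left (by omega)]

/-- Later successes overwrite earlier ones. Candidates start at 1 because 0 is the default value. -/
theorem findGreatest {p : Γ → ℕ → Prop} [∀ γ, DecidablePred (p γ)]
    (hp : Decides (fun γ : Γ × ℕ => p γ.1 (γ.2 + 1))) :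
    Computes (fun γ => Nat.findGreatest (p γ) (input γ).bound) := by
  refine ((const 0).iterate (s := fun γ i acc => if p γ (i + 1) then i + 1 else acc)
    (ite (Decides.fst hp) (snd.fst.add (const 1)) snd)).congr fun γ => ?_
  generalize (input γ).bound = B
  induction B with
  | zero => simp
  | succ B ih => rw [Nat.findGreatest_succ, ih]

end Computes

/-- A computable function of the number of vertices and the adjacency matrix is computed in
polynomial time by a program, whose loop bound may be any translate of the input size. -/
theorem Computes.exists_prog {f : Input → ℕ} (hf : Computes f) (c : ℕ) :
    ∃ (P : Prog) (p : Polynomial ℕ), ∀ (n : ℕ) (G : SimpleGraph (Fin n)),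
      ∃ (τ : State) (T : ℕ), Exec P (graphInput G) τ T ∧ T ≤ p.eval n ∧
        τ.reg 0 = f ⟨n, n + c, (graphInput G).arr 0, Nat.le_add_right n c⟩ := by
  obtain ⟨p, hp⟩ := hf
  obtain ⟨P, hP⟩ := hp id 2 le_rfl fun i hi => absurd hi (Nat.not_lt_zero i)
  refine ⟨.seq (.seq (.assign 1 (.add (.reg 0) (.const c))) P) (.assign 0 (.reg 2)),
    p.comp (.X + .C c) + 2, fun n G => ?_⟩
  have h0 : Exec (.assign 1 (.add (.reg 0) (.const c))) (graphInput G)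
    ((graphInput G).setReg 1 (n + c)) 1 := .assign _ _ _
  obtain ⟨τ, T, hT, hTp, hv, hr, ha⟩ := hP ((graphInput G).setReg 1 (n + c))
    ⟨n, n + c, (graphInput G).arr 0, Nat.le_add_right n c⟩
    ⟨fun i hi => absurd hi (Nat.not_lt_zero i), rfl, rfl, rfl⟩
  refine ⟨_, _, .seq (.seq h0 hT) (.assign _ _ _), ?_, ?_⟩
  · simp at hTp ⊢
    omega
  · simp [State.setReg, Expr.eval, hv]

end Ram

/-! ### The approximation algorithm and its running time -/

namespace Ram
open Context

namespace Input

variable (I : Input)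

/-- Adjacency of `u` and `v` in the graph given by the input array. -/
def Adj (u v : ℕ) : Prop := I.cell (I.n * u + v) ≠ 0

open Classical in
/-- The degree of the vertex `u`. -/
noncomputable def degree (u : ℕ) : ℕ := ∑ v ∈ Finset.range I.n, if I.Adj u v then 1 else 0

/-- The vertices of degree at least `d` are a clique, the other ones an independent set. -/
def SplitsAt (d : ℕ) : Prop :=
  ∀ u < I.n, ∀ v < I.n, ¬ u = v →
    (d ≤ I.degree u ∧ d ≤ I.degree v → I.Adj u v) ∧
      (I.degree u < d ∧ I.degree v < d → ¬ I.Adj u v)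

open Classical in
/-- A degree at which the graph splits into a clique and an independent set. -/
noncomputable def splitDegree : ℕ := Nat.findGreatest I.SplitsAt I.bound

/-- The vertex `v` belongs to the clique. -/
def High (v : ℕ) : Prop := I.splitDegree ≤ I.degree v

open Classical in
/-- The largest `k ≤ n` with `k ^ (k * k)` at most the loop bound. -/
noncomputable def blockSize : ℕ :=
  -- The minima match the cutoffs in `Computes.mul` and `Computes.pow`; for the value found they
  -- have no effect (`blockSize_spec`).
  Nat.findGreatest (fun k => k ≤ I.n ∧ min k I.bound * k ≤ I.bound ∧
    min k I.bound ^ min (min k I.bound * k) I.bound ≤ I.bound) I.bound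

/-- The vertices of the independent set in the `j`-th block. -/
def Low (j u : ℕ) : Prop :=
  I.blockSize * j ≤ u ∧ u < I.blockSize * j + I.blockSize ∧ I.degree u < I.splitDegree

/-- The `e`-th digit of `x` in base `blockSize`. -/
noncomputable def digit (x e : ℕ) : ℕ :=
  min (min x I.bound / I.blockSize ^ min e I.bound) I.bound % I.blockSize

/-- The weight which the code `x` assigns to the vertex `u` of the `j`-th block in the `i`-th
chain graph. -/
noncomputable def weight (j x i u : ℕ) : ℕ :=
  I.digit x (I.blockSize * i + (u - I.blockSize * j))

/-- The chain graphs given by the first `c` weight functions of the code `x` cover all edges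
between the clique and the `j`-th block. -/
def CoveredBy (j c x : ℕ) : Prop :=
  ∀ v < I.n, ∀ u < I.n, I.High v ∧ I.Low j u ∧ I.Adj v u →
    ∃ i < min c I.bound, ∀ t < I.n, I.Low j t ∧ I.weight j x i u ≤ I.weight j x i t → I.Adj v t

/-- The edges between the clique and the `j`-th block are covered by `c` chain graphs. -/
def Covered (j c : ℕ) : Prop := ∃ x < I.bound, I.CoveredBy j c x

open Classical in
/-- The number of chain graphs needed to cover the edges between the clique and the `j`-th
block. -/
noncomputable def blockCover (j : ℕ) : ℕ :=
  -- Being covered is monotone in `c`, so the last `c` for which `c - 1` fails is the least one that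
  -- succeeds. The default 0 is right for a block that needs no chain graph.
  Nat.findGreatest (fun c => ¬ I.Covered j (c - 1)) I.bound

/-- The graph has an edge. -/
def HasEdge : Prop := ∃ u < I.n, ∃ v < I.n, I.Adj u v

open Classical in
/-- An approximation of the threshold dimension. -/
noncomputable def approx : ℕ :=
  (∑ j ∈ Finset.range I.n, I.blockCover j) + if I.HasEdge then 1 else 0

theorem blockSize_le_bound : I.blockSize ≤ I.bound := Nat.findGreatest_le _

end Input

variable {Γ : Type} [Context Γ] {j c x i u v e : Γ → ℕ}

theorem Decides.adj (hu : Computes u) (hv : Computes v) :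
    Decides (fun γ => (input γ).Adj (u γ) (v γ)) :=
  (Decides.eq (Computes.cell ((Computes.n.mul hu).add hv)) (.const 0)).not.congr fun γ => by
    rw [min_eq_left (input γ).n_le]; rfl

theorem Computes.degree (hu : Computes u) : Computes (fun γ => (input γ).degree (u γ)) := by
  classical
  exact Computes.sum .n (Decides.adj hu.fst .snd).indicator fun γ => (input γ).n_le

theorem Decides.splitsAt (hu : Computes u) : Decides (fun γ => (input γ).SplitsAt (u γ)) := by
  refine .ball .n (.ball (p := fun (γ : Γ × ℕ) v => ¬ γ.2 = v →
    (u γ.1 ≤ (input γ.1).degree γ.2 ∧ u γ.1 ≤ (input γ.1).degree v → (input γ.1).Adj γ.2 v) ∧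
      ((input γ.1).degree γ.2 < u γ.1 ∧ (input γ.1).degree v < u γ.1 → ¬ (input γ.1).Adj γ.2 v))
    (N := fun γ => (input γ).n) .n ?_ fun γ => (input γ).n_le) fun γ => (input γ).n_le
  have hd : Computes (fun γ : (Γ × ℕ) × ℕ => u γ.1.1) := hu.fst.fst
  have h1 : Computes (fun γ : (Γ × ℕ) × ℕ => γ.1.2) := Computes.snd.fst
  have h2 : Computes (fun γ : (Γ × ℕ) × ℕ => γ.2) := .snd
  exact (Decides.eq h1 h2).not.imp
    ((((Decides.le hd h1.degree).and (.le hd h2.degree)).imp (.adj h1 h2)).and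
    (((Decides.lt h1.degree hd).and (.lt h2.degree hd)).imp (Decides.adj h1 h2).not))

theorem Computes.splitDegree : Computes (fun γ : Γ => (input γ).splitDegree) := by
  classical
  exact .findGreatest (Decides.splitsAt (Γ := Γ × ℕ) (Computes.snd.add (.const 1)))

theorem Computes.blockSize : Computes (fun γ : Γ => (input γ).blockSize) := by
  have h : Computes (fun γ : Γ × ℕ => γ.2 + 1) := Computes.snd.add (.const 1)
  exact .findGreatest (p := fun γ k => k ≤ (input γ).n ∧
    min k (input γ).bound * k ≤ (input γ).bound ∧
    min k (input γ).bound ^ min (min k (input γ).bound * k) (input γ).bound ≤ (input γ).bound)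
    ((Decides.le h .n).and ((Decides.le (h.mul h) .bound).and (.le (h.pow (h.mul h)) .bound)))

theorem Decides.high (hv : Computes v) : Decides (fun γ => (input γ).High (v γ)) :=
  .le .splitDegree hv.degree

theorem Computes.blockSize_mul (hu : Computes u) :
    Computes (fun γ => (input γ).blockSize * u γ) :=
  (Computes.blockSize.mul hu).congr fun γ => by
    rw [min_eq_left (input γ).blockSize_le_bound]

theorem Decides.low (hj : Computes j) (hu : Computes u) :
    Decides (fun γ => (input γ).Low (j γ) (u γ)) :=
  (Decides.le hj.blockSize_mul hu).and
    ((Decides.lt hu (hj.blockSize_mul.add .blockSize)).and (.lt hu.degree .splitDegree))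

theorem Computes.digit (hx : Computes x) (he : Computes e) :
    Computes (fun γ => (input γ).digit (x γ) (e γ)) := by
  refine (mod (div hx (pow .blockSize he)) .blockSize).congr fun γ => ?_
  rw [min_eq_left (input γ).blockSize_le_bound]
  rfl

theorem Computes.weight (hj : Computes j) (hx : Computes x) (hi : Computes i) (hu : Computes u) :
    Computes (fun γ => (input γ).weight (j γ) (x γ) (i γ) (u γ)) :=
  hx.digit (hi.blockSize_mul.add (hu.sub hj.blockSize_mul))

theorem Decides.coveredBy (hj : Computes j) (hc : Computes c) (hx : Computes x) :
    Decides (fun γ => (input γ).CoveredBy (j γ) (c γ) (x γ)) := by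
  have hv : Computes (fun γ : (Γ × ℕ) × ℕ => γ.1.2) := Computes.snd.fst
  have hu : Computes (fun γ : (Γ × ℕ) × ℕ => γ.2) := .snd
  have ht : Computes (fun γ : (((Γ × ℕ) × ℕ) × ℕ) × ℕ => γ.2) := .snd
  have hi : Computes (fun γ : (((Γ × ℕ) × ℕ) × ℕ) × ℕ => γ.1.2) := Computes.snd.fst
  have h := (((Decides.low hj.fst.fst.fst.fst ht).and (.le
    (.weight hj.fst.fst.fst.fst hx.fst.fst.fst.fst hi hu.fst.fst)
    (.weight hj.fst.fst.fst.fst hx.fst.fst.fst.fst hi ht))).imp (.adj hv.fst.fst ht))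
  refine .ball (p := fun γ v => ∀ u < (input γ).n,
    (input γ).High v ∧ (input γ).Low (j γ) u ∧ (input γ).Adj v u →
    ∃ i < min (c γ) (input γ).bound, ∀ t < (input γ).n, (input γ).Low (j γ) t ∧
      (input γ).weight (j γ) (x γ) i u ≤ (input γ).weight (j γ) (x γ) i t → (input γ).Adj v t)
    .n ?_ fun γ => (input γ).n_le
  refine .ball (Γ := Γ × ℕ) (N := fun γ => (input γ).n) (p := fun γ u =>
    (input γ).High γ.2 ∧ (input γ).Low (j γ.1) u ∧ (input γ).Adj γ.2 u →
    ∃ i < min (c γ.1) (input γ).bound, ∀ t < (input γ).n, (input γ).Low (j γ.1) t ∧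
      (input γ).weight (j γ.1) (x γ.1) i u ≤ (input γ).weight (j γ.1) (x γ.1) i t →
        (input γ).Adj γ.2 t)
    .n ?_ fun γ => (input γ).n_le
  refine .imp ((Decides.high hv).and ((Decides.low hj.fst.fst hu).and (.adj hv hu))) ?_
  refine .bex (Γ := (Γ × ℕ) × ℕ) (N := fun γ => min (c γ.1.1) (input γ).bound)
    (p := fun γ i => ∀ t < (input γ).n, (input γ).Low (j γ.1.1) t ∧
      (input γ).weight (j γ.1.1) (x γ.1.1) i γ.2 ≤ (input γ).weight (j γ.1.1) (x γ.1.1) i t →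
        (input γ).Adj γ.1.2 t)
    (hc.fst.fst.min .bound) ?_ fun γ => min_le_right _ _
  exact .ball (Γ := ((Γ × ℕ) × ℕ) × ℕ) (N := fun γ => (input γ).n)
    (p := fun γ t => (input γ).Low (j γ.1.1.1) t ∧
      (input γ).weight (j γ.1.1.1) (x γ.1.1.1) γ.2 γ.1.2 ≤
        (input γ).weight (j γ.1.1.1) (x γ.1.1.1) γ.2 t → (input γ).Adj γ.1.1.2 t)
    .n h fun γ => (input γ).n_le

theorem Decides.covered (hj : Computes j) (hc : Computes c) :
    Decides (fun γ => (input γ).Covered (j γ) (c γ)) :=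
  .bex .bound (.coveredBy hj.fst hc.fst .snd) fun _ => le_rfl

theorem Computes.blockCover (hj : Computes j) :
    Computes (fun γ => (input γ).blockCover (j γ)) := by
  classical
  exact .findGreatest (p := fun γ c => ¬ (input γ).Covered (j γ) (c - 1))
    (Decides.covered hj.fst ((Computes.snd.add (.const 1)).sub (.const 1))).not

theorem Decides.hasEdge : Decides (fun γ : Γ => (input γ).HasEdge) :=
  .bex .n (.bex (Γ := Γ × ℕ) (N := fun γ => (input γ).n) (p := fun γ v => (input γ).Adj γ.2 v)
    .n (.adj (Γ := (Γ × ℕ) × ℕ) Computes.snd.fst .snd) fun γ => (input γ).n_le)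
    fun γ => (input γ).n_le

theorem Computes.approx : Computes (fun γ : Γ => (input γ).approx) := by
  classical
  exact .add (.sum .n (Computes.blockCover .snd) fun γ => (input γ).n_le)
    (Decides.hasEdge.indicator.congr fun γ => by congr)

end Ram

/-! ### Chain graphs as threshold graphs, and degrees in split graphs -/

namespace SimpleGraph

variable {V : Type*} {G : SimpleGraph V}

theorem HasThresholdCover.of_fintype {ι : Type*} [Fintype ι] (T : ι → SimpleGraph V)
    (h : ∀ i, T i ≤ G ∧ (T i).IsThresholdGraph) (hc : ∀ u v, G.Adj u v → ∃ i, (T i).Adj u v) :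
    G.HasThresholdCover (Fintype.card ι) := by
  refine ⟨fun i => T ((Fintype.equivFin ι).symm i), fun i => h _, fun u v huv => ?_⟩
  obtain ⟨i, hi⟩ := hc u v huv
  exact ⟨Fintype.equivFin ι i, by simpa using hi⟩

/-- The clique `K` together with a chain graph between `K` and `S`: a vertex of `K` is joined
to all vertices of `S` whose weight is so large that `G` has all edges of this kind. -/
def chainGraph (G : SimpleGraph V) (K S : Set V) (w : V → ℕ) : SimpleGraph V :=
  fromRel fun v u => v ∈ K ∧ (u ∈ K ∨ u ∈ S ∧ ∀ t ∈ S, w u ≤ w t → G.Adj v t)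

theorem chainGraph_le {K S : Set V} (hK : G.IsClique K) (w : V → ℕ) :
    G.chainGraph K S w ≤ G := by
  intro u v h
  obtain ⟨hne, (⟨hu, hv | ⟨hv, h⟩⟩ | ⟨hv, hu | ⟨hu, h⟩⟩)⟩ := (fromRel_adj _ _ _).1 h
  · exact hK hu hv hne
  · exact h v hv le_rfl
  · exact hK hu hv hne
  · exact (h u hu le_rfl).symm

/-- The condition on `w u` is upward closed, hence equivalent to `τ v ≤ w u` for a threshold `τ v ≤
N`. Large positive weights on `K` and negative ones elsewhere then realize all adjacencies. -/
theorem isThresholdGraph_chainGraph {K S : Set V} {w : V → ℕ} {N : ℕ}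
    (hw : ∀ v, w v < N) : (G.chainGraph K S w).IsThresholdGraph := by
  classical
  let A : V → Set ℕ := fun v => {a | ∀ t ∈ S, a ≤ w t → G.Adj v t}
  have hA : ∀ v, N ∈ A v := fun v t _ ht => absurd ht (hw t).not_ge
  let τ : V → ℕ := fun v => sInf (A v)
  have hτN : ∀ v, (τ v : ℝ) ≤ N := fun v => by exact_mod_cast Nat.sInf_le (hA v)
  have hτ : ∀ v u, (∀ t ∈ S, w u ≤ w t → G.Adj v t) ↔ τ v ≤ w u := fun v u =>
    ⟨fun h => Nat.sInf_le h, fun h t ht hut => Nat.sInf_mem ⟨N, hA v⟩ t ht (h.trans hut)⟩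
  have hwN : ∀ v, (w v : ℝ) < N := fun v => by exact_mod_cast hw v
  have hw0 : ∀ v, (0 : ℝ) ≤ w v := fun v => by positivity
  have hτ0 : ∀ v, (0 : ℝ) ≤ τ v := fun v => by positivity
  -- A sum over `K` and `S` is `w u - τ v`. The shift by `N + 1` makes sums within `K` positive and
  -- those outside `K` negative, and `-(N + 2)` outweighs every vertex of `K`.
  refine ⟨0, fun v => if v ∈ K then N + 1 - τ v else if v ∈ S then w v - (N + 1) else -(N + 2),
    fun u v huv => ?_⟩
  have e1 := hτN u
  have e2 := hτN v
  have e3 := hwN u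
  have e4 := hwN v
  have e5 := hw0 u
  have e6 := hτ0 u
  have e7 := hτ0 v
  simp only [chainGraph, fromRel_adj, hτ, huv, ne_eq, not_false_eq_true, true_and]
  by_cases hu : u ∈ K <;> by_cases hv : v ∈ K
  · simp only [hu, hv, true_and, true_or, if_true, true_iff]
    linarith
  · by_cases hvS : v ∈ S
    · simp only [hu, hv, hvS, true_and, false_or, false_and, or_false, if_true, if_false]
      rw [← Nat.cast_le (α := ℝ)]
      constructor <;> intro h <;> linarith
    · simp only [hu, hv, hvS, if_true, if_false, false_and, and_false, or_false, false_iff]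
      intro h
      linarith
  · by_cases huS : u ∈ S
    · simp only [hu, hv, huS, true_and, false_or, false_and, if_true, if_false]
      rw [← Nat.cast_le (α := ℝ)]
      constructor <;> intro h <;> linarith
    · simp only [hu, hv, huS, if_true, if_false, false_and, and_false, or_false, false_iff]
      intro h
      linarith
  · simp only [hu, hv, if_false, false_and, or_false, false_iff]
    intro h
    split_ifs at h <;> linarith

/-- A split graph has a split partition which is determined by the degrees. -/
theorem IsSplitGraph.exists_degree [Fintype V] [DecidableRel G.Adj] (h : G.IsSplitGraph) :
    ∃ d ≤ Fintype.card V, ∀ u v, u ≠ v → (d ≤ G.degree u ∧ d ≤ G.degree v → G.Adj u v) ∧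
      (G.degree u < d ∧ G.degree v < d → ¬ G.Adj u v) := by
  classical
  obtain ⟨K₀, hK₀⟩ := h
  let 𝒦 := Finset.univ.filter fun K : Finset V =>
    G.IsClique (K : Set V) ∧ G.IsIndepSet ((K : Set V)ᶜ)
  -- Take the split partition with the largest clique.
  obtain ⟨K, hK, hmax⟩ := 𝒦.exists_max_image Finset.card
    ⟨K₀.toFinset, by simpa [𝒦] using hK₀⟩
  obtain ⟨hcl, hind⟩ : G.IsClique (K : Set V) ∧ G.IsIndepSet ((K : Set V)ᶜ) := by
    simpa [𝒦] using hK
  have hsub : ∀ u ∉ K, G.neighborFinset u ⊆ K := by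
    intro u hu v hv
    by_contra hvK
    have hv' : G.Adj u v := by simpa using hv
    exact hind (by simpa using hu) (by simpa using hvK) hv'.ne hv'
  -- Otherwise `u` is adjacent to all of `K` and could be added to it.
  have hout : ∀ u ∉ K, G.degree u < K.card := by
    intro u hu
    refine Finset.card_lt_card ⟨hsub u hu, fun hK => ?_⟩
    have hmem : insert u K ∈ 𝒦 := by
      simp only [𝒦, Finset.mem_filter, Finset.mem_univ, true_and, Finset.coe_insert]
      refine ⟨(isClique_insert_of_notMem (by simpa using hu)).2
        ⟨hcl, fun b hb => by simpa using hK hb⟩, ?_⟩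
      exact Set.Pairwise.mono (by intro x hx; simp at hx ⊢; tauto) hind
    have := hmax _ hmem
    rw [Finset.card_insert_of_notMem hu] at this
    omega
  have herase : ∀ v ∈ K, K.erase v ⊆ G.neighborFinset v := by
    intro v hv u hu
    obtain ⟨hne, hu⟩ := Finset.mem_erase.1 hu
    simpa using hcl (by simpa using hv) (by simpa using hu) hne.symm
  have hin : ∀ v ∈ K, K.card - 1 ≤ G.degree v := by
    intro v hv
    rw [← Finset.card_erase_of_mem hv]
    exact Finset.card_le_card (herase v hv)
  -- If no outer vertex reaches degree `K.card - 1`, this value separates `K` from its complement.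
  -- If some `z` does, the cut at `K.card` may move vertices of `K` to the low side, but no two
  -- adjacent ones: both would have all their neighbours in `K`, so `z` would miss two vertices of
  -- `K` and have too small a degree.
  by_cases hA : ∃ u ∉ K, K.card - 1 ≤ G.degree u
  · obtain ⟨z, hz, hzd⟩ := hA
    have hK1 : 0 < K.card := (Nat.zero_le _).trans_lt (hout z hz)
    have mem : ∀ v, K.card ≤ G.degree v → v ∈ K := fun v hv => by
      by_contra h
      exact absurd hv (hout v h).not_ge
    refine ⟨K.card, Finset.card_le_univ K, fun u v huv => ⟨fun ⟨hu, hv⟩ =>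
      hcl (mem u hu) (mem v hv) huv, fun ⟨hu, hv⟩ hadj => ?_⟩⟩
    have nbr : ∀ x ∈ K, G.degree x < K.card → G.neighborFinset x = K.erase x := by
      intro x hx hxd
      refine (Finset.eq_of_subset_of_card_le (herase x hx) ?_).symm
      rw [Finset.card_erase_of_mem hx]
      change G.degree x ≤ _
      omega
    have both : u ∈ K ∧ v ∈ K := by
      by_cases h1 : u ∈ K
      · have : v ∈ K.erase u := by rw [← nbr u h1 hu]; simpa using hadj
        exact ⟨h1, Finset.mem_of_mem_erase this⟩
      · by_cases h2 : v ∈ K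
        · have : u ∈ K.erase v := by rw [← nbr v h2 hv]; simpa using hadj.symm
          exact ⟨Finset.mem_of_mem_erase this, h2⟩
        · exact absurd hadj (hind (by simpa using h1) (by simpa using h2) huv)
    have hnz : ∀ x ∈ K, G.degree x < K.card → x ∉ G.neighborFinset z := by
      intro x hx hxd hxz
      have : z ∈ G.neighborFinset x := by simpa [adj_comm] using hxz
      rw [nbr x hx hxd] at this
      exact hz (Finset.mem_of_mem_erase this)
    have hle : G.neighborFinset z ⊆ (K.erase u).erase v := by
      intro x hx
      refine Finset.mem_erase.2 ⟨?_, Finset.mem_erase.2 ⟨?_, hsub z hz hx⟩⟩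
      · rintro rfl
        exact hnz _ both.2 hv hx
      · rintro rfl
        exact hnz _ both.1 hu hx
    have hcard := Finset.card_le_card hle
    rw [Finset.card_erase_of_mem (Finset.mem_erase.2 ⟨huv.symm, both.2⟩),
      Finset.card_erase_of_mem both.1] at hcard
    have : 1 < K.card := Finset.one_lt_card.2 ⟨u, both.1, v, both.2, huv⟩
    change G.degree z ≤ _ at hcard
    omega
  · push Not at hA
    have mem : ∀ v, K.card - 1 ≤ G.degree v → v ∈ K := fun v hv => by
      by_contra h
      exact absurd hv (hA v h).not_ge
    have hnot : ∀ v, G.degree v < K.card - 1 → v ∉ K := fun v hv h =>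
      absurd hv (hin v h).not_gt
    exact ⟨K.card - 1, (Nat.sub_le _ _).trans (Finset.card_le_univ K), fun u v huv =>
      ⟨fun ⟨hu, hv⟩ => hcl (mem u hu) (mem v hv) huv, fun ⟨hu, hv⟩ =>
        hind (by simpa using hnot u hu) (by simpa using hnot v hv) huv⟩⟩

end SimpleGraph

/-! ### Block size, codes of weight functions, and covers of one block -/

namespace Ram.Input

variable (I : Input) {j c : ℕ}

theorem blockSize_spec (hB : 0 < I.bound) : I.blockSize ≤ I.n ∧
    I.blockSize * I.blockSize ≤ I.bound ∧ I.blockSize ^ (I.blockSize * I.blockSize) ≤ I.bound := by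
  classical
  -- The value 0 qualifies because `0 ^ 0 = 1 ≤ bound`.
  have h := Nat.findGreatest_spec (P := fun k => k ≤ I.n ∧ min k I.bound * k ≤ I.bound ∧
    min k I.bound ^ min (min k I.bound * k) I.bound ≤ I.bound) (Nat.zero_le I.bound)
    (by simpa using Nat.one_le_iff_ne_zero.2 hB.ne')
  change I.blockSize ≤ I.n ∧ min I.blockSize I.bound * I.blockSize ≤ I.bound ∧
    min I.blockSize I.bound ^ min (min I.blockSize I.bound * I.blockSize) I.bound ≤ I.bound at h
  rw [min_eq_left I.blockSize_le_bound] at h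
  rwa [min_eq_left h.2.1] at h

theorem le_blockSize {k : ℕ} (hn : k ≤ I.n) (hk : k ^ (k * k) ≤ I.bound) : k ≤ I.blockSize := by
  classical
  have hkB : k ≤ I.bound := hn.trans I.n_le
  have hkk : k * k ≤ I.bound := by
    rcases Nat.lt_or_ge 1 k with h | h
    · exact ((Nat.lt_pow_self h).le).trans hk
    · calc k * k ≤ k * 1 := Nat.mul_le_mul_left k h
        _ ≤ I.bound := by omega
  refine Nat.le_findGreatest hkB ⟨hn, ?_⟩
  rw [min_eq_left hkB, min_eq_left hkk]
  exact ⟨hkk, hk⟩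

variable {I}

theorem CoveredBy.mono {x c' : ℕ} (h : I.CoveredBy j c x) (hc : c ≤ c') :
    I.CoveredBy j c' x := fun v hv u hu huv => by
  obtain ⟨i, hi, h⟩ := h v hv u hu huv
  exact ⟨i, by omega, h⟩

theorem Covered.mono {c' : ℕ} (h : I.Covered j c) (hc : c ≤ c') : I.Covered j c' := by
  obtain ⟨x, hx, h⟩ := h
  exact ⟨x, hx, h.mono hc⟩

theorem Covered.blockCover_le (h : I.Covered j c) : I.blockCover j ≤ c := by
  classical
  by_contra hlt
  push Not at hlt
  exact Nat.findGreatest_of_ne_zero (P := fun c => ¬ I.Covered j (c - 1)) (n := I.bound)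
    (m := I.blockCover j) rfl (by omega) (h.mono (by omega))

/-- If the value found failed, its successor would satisfy the searched predicate; `hc` keeps that
successor within the range of the search. -/
theorem Covered.covered_blockCover (h : I.Covered j c) (hc : c < I.bound) :
    I.Covered j (I.blockCover j) := by
  classical
  by_contra hn
  exact Nat.findGreatest_is_greatest (P := fun c => ¬ I.Covered j (c - 1)) (n := I.bound)
    (k := I.blockCover j + 1) (Nat.lt_succ_self _) (by have := h.blockCover_le; omega)
    (by simpa using hn)

/-- Weights of any kind may be replaced by ranks, and these are the digits of a code. -/
theorem Covered.of_weights (hk : 0 < I.blockSize) (hc : c ≤ I.blockSize)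
    (w : ℕ → ℕ → ℝ) (h : ∀ v < I.n, ∀ u < I.n, I.High v ∧ I.Low j u ∧ I.Adj v u →
      ∃ i < c, ∀ t < I.n, I.Low j t ∧ w i u ≤ w i t → I.Adj v t) : I.Covered j c := by
  classical
  obtain ⟨hkn, hkk, hpow⟩ :=
    I.blockSize_spec (hk.trans_le I.blockSize_le_bound)
  set k := I.blockSize with hkdef
  -- The rank of `u` is the number of strictly lighter vertices of its block. It is below `k`, and
  -- comparing ranks is comparing weights.
  let s : ℕ → ℕ → Finset ℕ := fun i u =>
    (Finset.Ico (k * j) (k * j + k)).filter fun t => I.Low j t ∧ w i t < w i u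
  have hs : ∀ i u, I.Low j u → (s i u).card < k := by
    intro i u hu
    calc (s i u).card < (Finset.Ico (k * j) (k * j + k)).card :=
          Finset.card_lt_card ((Finset.filter_ssubset).2
            ⟨u, Finset.mem_Ico.2 ⟨hu.1, hu.2.1⟩, by simp⟩)
      _ = k := by simp
  have hmono : ∀ i u t, I.Low j t → (s i u).card ≤ (s i t).card → w i u ≤ w i t := by
    intro i u t ht hle
    by_contra hlt
    push Not at hlt
    refine absurd hle (Finset.card_lt_card ⟨fun r hr => ?_, fun hsub => ?_⟩).not_ge
    · simp only [s, Finset.mem_filter] at hr ⊢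
      exact ⟨hr.1, hr.2.1, hr.2.2.trans hlt⟩
    · have : t ∈ s i t := hsub (by
        simp only [s, Finset.mem_filter]
        exact ⟨Finset.mem_Ico.2 ⟨ht.1, ht.2.1⟩, ht, hlt⟩)
      simp [s] at this
  -- Digit `k * i + r` is the rank of the `r`-th block vertex under the `i`-th weight. The remainder
  -- only makes `f` total: ranks of low vertices are already below `k`.
  let f : Fin (k * k) → Fin k := fun e =>
    ⟨(s (e / k) (k * j + e % k)).card % k, Nat.mod_lt _ hk⟩
  let x : Fin (k ^ (k * k)) := finFunctionFinEquiv f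
  have hx : (x : ℕ) < I.bound := x.2.trans_le hpow
  have hdigit : ∀ e : Fin (k * k), I.digit x e = f e := by
    intro e
    have h1 : f e = finFunctionFinEquiv.symm x e := by simp [x]
    rw [h1]
    simp only [digit, ← hkdef]
    rw [min_eq_left (a := (x : ℕ)) hx.le, min_eq_left (a := (e : ℕ)) (e.2.le.trans hkk),
      min_eq_left ((Nat.div_le_self _ _).trans hx.le)]
    rfl
  have hweight : ∀ i < k, ∀ u, I.Low j u → I.weight j x i u = (s i u).card := by
    intro i hi u hu
    have hu1 : k * j ≤ u := hu.1
    have hu2 : u < k * j + k := hu.2.1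
    have hr : u - k * j < k := by omega
    have hlt : k * i + (u - k * j) < k * k := by
      calc k * i + (u - k * j) < k * i + k := by omega
        _ = k * (i + 1) := by ring
        _ ≤ k * k := Nat.mul_le_mul_left k hi
    have h1 := hdigit ⟨_, hlt⟩
    simp only [f] at h1
    rw [Nat.mul_add_div hk, Nat.div_eq_of_lt hr, add_zero, Nat.mul_add_mod,
      Nat.mod_eq_of_lt hr, Nat.add_sub_cancel' hu1, Nat.mod_eq_of_lt (hs i u hu)] at h1
    exact h1
  refine ⟨x, hx, fun v hv u hu huv => ?_⟩
  obtain ⟨i, hi, hcov⟩ := h v hv u hu huv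
  refine ⟨i, lt_min hi (by have := I.blockSize_le_bound; omega), fun t ht htu => ?_⟩
  have hle := htu.2
  rw [hweight i (by omega) u huv.2.1, hweight i (by omega) t htu.1] at hle
  exact hcov t ht ⟨htu.1, hmono i u t htu.1 hle⟩

/-- One star per vertex of the block: the `i`-th weight is the indicator of the `i`-th vertex. -/
theorem covered_blockSize (hk : 0 < I.blockSize) :
    I.Covered j I.blockSize := by
  refine .of_weights hk le_rfl (fun i u => if u = I.blockSize * j + i then 1 else 0)
    fun v _ u _ huv => ⟨u - I.blockSize * j, ?_, fun t _ ht => ?_⟩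
  · have := huv.2.1.1
    have := huv.2.1.2.1
    omega
  · have hu : u = I.blockSize * j + (u - I.blockSize * j) := by
      have := huv.2.1.1
      omega
    have h1 := ht.2
    rw [if_pos hu] at h1
    split_ifs at h1 with h2
    · rw [h2, ← hu]
      exact huv.2.2
    · norm_num at h1

theorem blockCover_eq_zero (hB : 0 < I.bound) (hj : I.n ≤ I.blockSize * j) :
    I.blockCover j = 0 := by
  refine Nat.le_zero.1 (Covered.blockCover_le ⟨0, hB, fun v _ u hu huv => ?_⟩)
  have := huv.2.1.1
  omega

end Ram.Input

/-! ### Correctness and approximation factor of the algorithm -/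

namespace Ram

/-- The input given by a graph on the vertices `0, …, n - 1`. -/
noncomputable def Input.ofGraph {n : ℕ} (G : SimpleGraph (Fin n)) (c : ℕ) : Input :=
  ⟨n, n + c, (graphInput G).arr 0, Nat.le_add_right n c⟩

namespace Input

variable {n : ℕ} {G : SimpleGraph (Fin n)} {c : ℕ}

theorem adj_ofGraph (u v : Fin n) : (ofGraph G c).Adj u v ↔ G.Adj u v := by
  classical
  simp only [Adj, ofGraph, graphInput, true_and, ne_eq, ite_eq_right_iff, one_ne_zero, imp_false,
    not_not]
  constructor
  · rintro ⟨u', v', h, e⟩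
    have hn : 0 < n := u.pos
    have hu : (u : ℕ) = u' := by
      have h1 := congrArg (· / n) e
      simpa [Nat.mul_add_div hn, Nat.div_eq_of_lt] using h1
    have hv : (v : ℕ) = v' := by
      rw [hu] at e
      omega
    rwa [Fin.ext hu, Fin.ext hv]
  · exact fun h => ⟨u, v, h, rfl⟩

theorem degree_ofGraph [DecidableRel G.Adj] (u : Fin n) :
    (ofGraph G c).degree u = G.degree u := by
  classical
  have h : (ofGraph G c).degree u = ∑ v ∈ Finset.range n, if (ofGraph G c).Adj u v then 1 else 0 :=
    rfl
  rw [h, Finset.sum_range, ← SimpleGraph.card_neighborFinset_eq_degree,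
    SimpleGraph.neighborFinset_eq_filter, Finset.card_filter]
  exact Finset.sum_congr rfl fun v _ => by simp [adj_ofGraph]

theorem splitsAt_splitDegree (hG : G.IsSplitGraph) :
    (ofGraph G c).SplitsAt (ofGraph G c).splitDegree := by
  classical
  obtain ⟨d, hd, h⟩ := hG.exists_degree
  refine Nat.findGreatest_spec (P := (ofGraph G c).SplitsAt) (m := d) ?_ fun u hu v hv huv => ?_
  · rw [Fintype.card_fin] at hd
    exact hd.trans (Nat.le_add_right n c)
  · have := h ⟨u, hu⟩ ⟨v, hv⟩ fun e => huv (Fin.ext_iff.1 e)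
    rwa [← degree_ofGraph (c := c), ← degree_ofGraph (c := c), ← adj_ofGraph (c := c)] at this

theorem blockSize_ofGraph_pos (hc : 0 < c) (hn : 0 < n) : 0 < (ofGraph G c).blockSize :=
  le_blockSize (k := 1) _ hn (by simp only [one_pow, ofGraph]; omega)

theorem covered_blockCover_ofGraph (hc : 0 < c) (hn : 0 < n) (j : ℕ) :
    (ofGraph G c).Covered j ((ofGraph G c).blockCover j) := by
  have h0 : 0 < (ofGraph G c).bound := Nat.lt_add_left n hc
  refine (covered_blockSize (blockSize_ofGraph_pos hc hn)).covered_blockCover ?_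
  have h1 : (ofGraph G c).blockSize ≤ n := (blockSize_spec _ h0).1
  have h2 : (ofGraph G c).bound = n + c := rfl
  omega

theorem thresholdDimension_le_approx (hG : G.IsSplitGraph) (hc : 0 < c) :
    G.thresholdDimension ≤ (ofGraph G c).approx := by
  classical
  set I := ofGraph G c with hI
  have hIn : I.n = n := rfl
  have hsplit := splitsAt_splitDegree (c := c) hG
  rw [← hI] at hsplit
  by_cases hE : I.HasEdge
  swap
  · have h0 : G.HasThresholdCover 0 := by
      refine ⟨Fin.elim0, fun i => i.elim0, fun u v huv => ?_⟩
      exact absurd (show I.HasEdge from ⟨u, u.2, v, v.2, (adj_ofGraph u v).2 huv⟩) hE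
    exact (Nat.sInf_le h0).trans (Nat.zero_le _)
  have hn : 0 < n := by
    obtain ⟨u, hu, -⟩ := hE
    exact (Nat.zero_le u).trans_lt hu
  have hk := blockSize_ofGraph_pos (G := G) hc hn
  rw [← hI] at hk
  choose x hx hcov using covered_blockCover_ofGraph (G := G) hc hn
  rw [← hI] at hx hcov
  let K : Set (Fin n) := {v | I.High v}
  have hK : G.IsClique K := fun u hu v hv huv => by
    have := (hsplit u u.2 v v.2 (by simpa [Fin.ext_iff] using huv)).1 ⟨hu, hv⟩
    rwa [hI, adj_ofGraph] at this
  -- The graph at `none` is the complete graph on `K`; it accounts for the summand 1 in `approx`.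
  let T : Option (Σ j : Fin n, Fin (I.blockCover j)) → SimpleGraph (Fin n)
    | none => G.chainGraph K ∅ 0
    | some ⟨j, i⟩ => G.chainGraph K {u | I.Low j u} fun u => I.weight j (x j) i u
  have hcard : Fintype.card (Option (Σ j : Fin n, Fin (I.blockCover j))) = I.approx := by
    simp only [Fintype.card_option, Fintype.card_sigma, Fintype.card_fin, approx, hE, if_true, hIn]
    rw [Finset.sum_range]
  rw [← hcard]
  refine Nat.sInf_le (.of_fintype T ?_ fun u v huv => ?_)
  · rintro (_ | ⟨j, i⟩)
    · exact ⟨SimpleGraph.chainGraph_le hK _,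
        SimpleGraph.isThresholdGraph_chainGraph (N := 1) fun _ => Nat.one_pos⟩
    · exact ⟨SimpleGraph.chainGraph_le hK _,
        SimpleGraph.isThresholdGraph_chainGraph (N := I.blockSize) fun _ => Nat.mod_lt _ hk⟩
  have cross : ∀ v u : Fin n, v ∈ K → u ∉ K → G.Adj v u → ∃ i, (T i).Adj v u := by
    intro v u hv hu h
    let j : Fin n := ⟨u / I.blockSize, (Nat.div_le_self _ _).trans_lt u.2⟩
    have hlow : I.Low j u :=
      ⟨Nat.mul_div_le _ _, Nat.lt_mul_div_succ _ hk, not_le.1 hu⟩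
    obtain ⟨i, hi, hcv⟩ := hcov j v v.2 u u.2 ⟨hv, hlow, (adj_ofGraph v u).2 h⟩
    refine ⟨some ⟨j, i, hi.trans_le (min_le_left _ _)⟩,
      (SimpleGraph.fromRel_adj _ _ _).2 ⟨h.ne, .inl ⟨hv, .inr ⟨hlow, fun t ht hut => ?_⟩⟩⟩⟩
    exact (adj_ofGraph v t).1 (hcv t t.2 ⟨ht, hut⟩)
  by_cases hu : u ∈ K <;> by_cases hv : v ∈ K
  · exact ⟨none, (SimpleGraph.fromRel_adj _ _ _).2 ⟨huv.ne, .inl ⟨hu, .inl hv⟩⟩⟩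
  · exact cross u v hu hv huv
  · obtain ⟨i, hi⟩ := cross v u hv hu huv.symm
    exact ⟨i, hi.symm⟩
  · exact absurd ((adj_ofGraph u v).2 huv) ((hsplit u u.2 v v.2
      (by simpa [Fin.ext_iff] using huv.ne)).2 ⟨not_le.1 hu, not_le.1 hv⟩)

/-- The weights of the given threshold graphs serve for the block: if `w v + w u ≥ s` and `w r ≥ w
u`, then `w v + w r ≥ s`. If `t` exceeds the block size, for which codes have no room, the stars of
`covered_blockSize` suffice. -/
theorem blockCover_ofGraph_le (hc : 0 < c) (hn : 0 < n) {t : ℕ}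
    (ht : G.HasThresholdCover t) (j : ℕ) : (ofGraph G c).blockCover j ≤ t := by
  classical
  set I := ofGraph G c with hI
  have hk := blockSize_ofGraph_pos (G := G) hc hn
  rw [← hI] at hk
  rcases le_or_gt t I.blockSize with htk | htk
  swap
  · exact (covered_blockSize hk).blockCover_le.trans htk.le
  obtain ⟨T, hT, hcov⟩ := ht
  choose s w hw using fun i => (hT i).2
  refine Covered.blockCover_le (.of_weights hk htk
    (fun i u => if h : i < t ∧ u < n then w ⟨i, h.1⟩ ⟨u, h.2⟩ else 0)
    fun v (hv : v < n) u (hu : u < n) ⟨hvh, hul, hvu⟩ => ?_)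
  obtain ⟨i, hi⟩ := hcov ⟨v, hv⟩ ⟨u, hu⟩ ((adj_ofGraph _ _).1 hvu)
  refine ⟨i, i.2, fun r (hr : r < n) ⟨hrl, hur⟩ => ?_⟩
  -- The weights decide adjacency of distinct vertices only; here `v` is high and `r` is low.
  have hne : (⟨v, hv⟩ : Fin n) ≠ ⟨r, hr⟩ := by
    rintro h
    have h1 := hrl.2.2
    rw [← (Fin.mk.inj_iff.1 h : v = r)] at h1
    exact absurd hvh h1.not_ge
  refine (adj_ofGraph (c := c) ⟨v, hv⟩ ⟨r, hr⟩).2 ((hT i).1 ((hw i _ _ hne).2 ?_))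
  have h1 := (hw i _ _ hi.ne).1 hi
  simp only [i.2, hu, hr, and_self, dite_true] at hur
  exact h1.trans (by simpa using hur)

/-- At most `⌈n / k⌉` blocks start below `n`, and each costs at most `t(G)`. The extra graph occurs
only if there is an edge, and then `t(G) ≥ 1`. -/
theorem approx_le (hc : 0 < c) (hn : 0 < n) :
    (ofGraph G c).approx ≤
      (⌈(n : ℝ) / (ofGraph G c).blockSize⌉₊ + 1) * G.thresholdDimension := by
  classical
  have ht : G.HasThresholdCover G.thresholdDimension := Nat.sInf_mem G.exists_hasThresholdCover
  set t := G.thresholdDimension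
  set I := ofGraph G c with hI
  have hk := blockSize_ofGraph_pos (G := G) hc hn
  have hB : 0 < I.bound := Nat.lt_add_left n hc
  rw [← hI] at hk
  rw [add_mul, one_mul, approx]
  refine Nat.add_le_add ?_ ?_
  · calc ∑ j ∈ Finset.range n, I.blockCover j
        = ∑ j ∈ (Finset.range n).filter (fun j => I.blockSize * j < n), I.blockCover j := by
          refine (Finset.sum_filter_of_ne fun j _ hj => ?_).symm
          by_contra h
          exact hj (blockCover_eq_zero hB (not_lt.1 h))
      _ ≤ ∑ j ∈ Finset.range ⌈(n : ℝ) / I.blockSize⌉₊, t := by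
          refine Finset.sum_le_sum_of_subset_of_nonneg (fun j hj => ?_) (by simp) |>.trans
            (Finset.sum_le_sum fun j _ => blockCover_ofGraph_le hc hn ht j)
          rw [Finset.mem_range, Nat.lt_ceil, lt_div_iff₀ (by exact_mod_cast hk), mul_comm]
          exact_mod_cast (Finset.mem_filter.1 hj).2
      _ = _ := by simp
  · split_ifs with hE
    · obtain ⟨u, hu, v, hv, huv⟩ := hE
      refine Nat.one_le_iff_ne_zero.2 fun h0 => ?_
      rw [h0] at ht
      obtain ⟨T, -, hcov⟩ := ht
      obtain ⟨i, -⟩ := hcov ⟨u, hu⟩ ⟨v, hv⟩ ((adj_ofGraph (c := c) _ _).1 huv)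
      exact i.elim0
    · exact Nat.zero_le _

end Input

end Ram

/-! ### Asymptotics of the block size -/

namespace Ram
open Filter

/-- Here `L = log n` and `β = log b`. If the conclusion failed, `k + 1` would be at most `√L`, so
`log (k + 1)` would be at most about half of `log L`, and `(k + 1) ^ 2 * log (k + 1)` would stay
below `L`. -/
theorem le_sq_mul_log_div {β L : ℝ} (hβ : 0 < β) (hL : 0 < L) (h1 : 4 ≤ Real.log (L / β))
    (h2 : 4 * Real.log β ≤ Real.log L) (h3 : 25 * Real.log (L / β) ≤ L) {k : ℝ} (hk : 0 ≤ k)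
    (h : L < (k + 1) ^ 2 * Real.log (k + 1)) : L ≤ k ^ 2 * Real.log (L / β) := by
  by_contra hlt
  push Not at hlt
  have hl := Real.log_div hL.ne' hβ.ne'
  set ℓ := Real.log (L / β)
  -- From `(k - 5) ^ 2 ≥ 0` one gets `(k + 1) ^ 2 ≤ 1.2 * k ^ 2 + 6`; then `k ^ 2 * ℓ < L` and `25 *
  -- ℓ ≤ L` give `1.2 + 6 / 25 = 1.44`.
  have hsq : (k + 1) ^ 2 * ℓ ≤ 1.44 * L := by
    nlinarith [mul_nonneg (sq_nonneg (k - 5)) (by linarith : 0 ≤ ℓ)]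
  have hsqL : (k + 1) ^ 2 ≤ L := by nlinarith [sq_nonneg (k + 1)]
  have hlog : 2 * Real.log (k + 1) ≤ Real.log L := by
    have := Real.log_le_log (by positivity) hsqL
    rwa [Real.log_pow] at this
  -- By `h2`, `log L ≤ 4 / 3 * ℓ`, and half of this is `2 / 3 * ℓ`. The contradiction is `2 / 3 *
  -- 1.44 = 0.96 < 1`.
  have : (k + 1) ^ 2 * Real.log (k + 1) ≤ (k + 1) ^ 2 * (2 / 3 * ℓ) :=
    mul_le_mul_of_nonneg_left (by linarith) (sq_nonneg _)
  nlinarith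

theorem eventually_div_le {b : ℝ} (hb : 1 < b) : ∀ᶠ n : ℕ in atTop, ∀ k : ℕ, 0 < k →
    n < (k + 1) ^ ((k + 1) * (k + 1)) →
    (n : ℝ) / k ≤ n * √(Real.logb b (Real.logb b n)) / √(Real.logb b n) := by
  have hβ : 0 < Real.log b := Real.log_pos hb
  have hL : Tendsto (fun n : ℕ => Real.log n) atTop atTop :=
    Real.tendsto_log_atTop.comp tendsto_natCast_atTop_atTop
  have hl : Tendsto (fun L => Real.log (L / Real.log b)) atTop atTop :=
    Real.tendsto_log_atTop.comp (tendsto_id.atTop_div_const hβ)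
  have ho : ∀ᶠ x : ℝ in atTop, 25 * Real.log x ≤ Real.log b * x := by
    have := Real.isLittleO_log_id_atTop.bound (c := Real.log b / 25) (by positivity)
    filter_upwards [this, eventually_gt_atTop 0] with x hx hx0
    have h1 := (le_abs_self _).trans hx
    simp only [id, Real.norm_eq_abs, abs_of_pos hx0] at h1
    linarith
  have ho' := (tendsto_id.atTop_div_const hβ).eventually ho
  filter_upwards [hL.eventually_gt_atTop 0, hL.eventually (hl.eventually_ge_atTop 4),
    hL.eventually (Real.tendsto_log_atTop.eventually_ge_atTop (4 * Real.log (Real.log b))),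
    hL.eventually ho'] with n h0 h1 h2 h3 k hk hn
  have hk' : (0 : ℝ) < k := by exact_mod_cast hk
  have hn0 : (0 : ℝ) < n := by
    rcases Nat.eq_zero_or_pos n with rfl | h
    · simp at h0
    · exact_mod_cast h
  have h4 : Real.log n < ((k : ℝ) + 1) ^ 2 * Real.log (k + 1) := by
    have : (n : ℝ) < ((k : ℝ) + 1) ^ ((k + 1) * (k + 1)) := by exact_mod_cast hn
    have := Real.log_lt_log hn0 this
    rw [Real.log_pow] at this
    push_cast at this
    linarith
  have h5 := le_sq_mul_log_div hβ h0 h1 h2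
    (by simpa [mul_div_cancel₀, hβ.ne', mul_div_assoc'] using h3) hk'.le h4
  have hlb : Real.logb b n = Real.log n / Real.log b := rfl
  have hq : 0 < Real.logb b n := by rw [hlb]; positivity
  rw [mul_div_assoc, div_eq_mul_one_div]
  refine mul_le_mul_of_nonneg_left ?_ hn0.le
  rw [← Real.sqrt_div' _ hq.le]
  refine Real.le_sqrt_of_sq_le ?_
  -- The base survives only inside the outer logarithm, since `log b` cancels in the quotient.
  rw [hlb, Real.logb, div_div_div_cancel_right₀ hβ.ne', div_pow, one_pow,
    div_le_div_iff₀ (by positivity) h0]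
  linarith

end Ram

/-! ### Choice of the constant and conclusion -/

theorem mainTheorem4 (b : ℝ) (hb : 1 < b) :
    ∃ (P : Ram.Prog) (p : Polynomial ℕ),
      ∀ (n : ℕ) (G : SimpleGraph (Fin n)), G.IsSplitGraph →
        ∃ (τ : Ram.State) (T : ℕ),
          Ram.Exec P (Ram.graphInput G) τ T ∧ T ≤ p.eval n ∧
          G.thresholdDimension ≤ τ.reg 0 ∧
          (b < (n : ℝ) →
            τ.reg 0 ≤
              2 * ⌈(n : ℝ) * √(Real.logb b (Real.logb b n)) / √(Real.logb b n)⌉₊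
                * G.thresholdDimension) := by
  obtain ⟨N, hN⟩ := Filter.eventually_atTop.1 (Ram.eventually_div_le hb)
  -- With this `c`, every `n < N` has block size `n`, a single block, so the asymptotic estimate is
  -- needed only for `n ≥ N`.
  set c := N ^ (N * N) + 1 with hc
  have hc0 : 0 < c := Nat.succ_pos _
  obtain ⟨P, p, hP⟩ := Ram.Computes.approx.exists_prog c
  refine ⟨P, p, fun n G hG => ?_⟩
  obtain ⟨τ, T, hT, hTp, hτ⟩ := hP n G
  change τ.reg 0 = (Ram.Input.ofGraph G c).approx at hτ
  refine ⟨τ, T, hT, hTp, hτ ▸ Ram.Input.thresholdDimension_le_approx hG hc0, fun hbn => ?_⟩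
  have hn1 : (1 : ℝ) < n := hb.trans hbn
  have hn : 0 < n := by
    have : 1 < n := by exact_mod_cast hn1
    omega
  rw [hτ]
  refine (Ram.Input.approx_le hc0 hn).trans (Nat.mul_le_mul_right _ ?_)
  set I := Ram.Input.ofGraph G c with hI
  have hlog : 1 < Real.logb b n := by
    rwa [Real.lt_logb_iff_rpow_lt hb (by linarith), Real.rpow_one]
  -- The ceiling is at least 1 and so absorbs the summand 1 of `approx_le`; this is the origin of
  -- the factor 2.
  have hpos : 0 < ⌈(n : ℝ) * √(Real.logb b (Real.logb b n)) / √(Real.logb b n)⌉₊ := by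
    have := Real.logb_pos hb hlog
    exact Nat.ceil_pos.2 (by positivity)
  have hkn : I.blockSize ≤ n := (Ram.Input.blockSize_spec I (Nat.lt_add_left n hc0)).1
  have hk : 0 < I.blockSize := Ram.Input.blockSize_ofGraph_pos hc0 hn
  rcases hkn.eq_or_lt with heq | hlt
  · rw [heq, div_self (by positivity), Nat.ceil_one]
    omega
  · have hfail : n + c < (I.blockSize + 1) ^ ((I.blockSize + 1) * (I.blockSize + 1)) := by
      by_contra h
      exact absurd (Ram.Input.le_blockSize I (k := I.blockSize + 1) hlt (not_lt.1 h)) (by omega)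
    have hNn : N ≤ n := by
      by_contra h
      push Not at h
      have : (I.blockSize + 1) ^ ((I.blockSize + 1) * (I.blockSize + 1)) ≤ N ^ (N * N) :=
        (Nat.pow_le_pow_left (by omega) _).trans
          (Nat.pow_le_pow_right (by omega) (Nat.mul_le_mul (by omega) (by omega)))
      omega
    have := Nat.ceil_le_ceil (hN n hNn _ hk (by omega))
    omega
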